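/- Let $q$ be a complex number with $|q|<1$. Write $$(a;q)_\infty=\prod_{k=0}^{\infty}(1-aq^k),\qquad \psi(q)=\sum_{n=0}^{\infty}q^{n(n+1)/2},$$ and, for real $a$, $$f_a(q)=\sum_{n=0}^{\infty}\frac{q^{n^2}}{(1+aq+q^2)(1+aq^2+q^4)\cdots(1+aq^n+q^{2n})}.$$ Then $$\frac{1+\sqrt3}{2}\,f_{-1}(-q)+\frac{3+\sqrt3}{6}\,f_{1}(-q)-f_{\sqrt3}(q)=\frac{2}{\sqrt3}\,\psi(-q)\,\frac{(q^4;q^4)_\infty}{(q^6;q^6)_\infty}\prod_{n=1}^{\infty}\frac{1}{1+\sqrt3\,q^n+q^{2n}},$$ where all denominators occurring are nonzero and all the series and infinite products occurring converge (unconditionally). -/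

import Mathlib

noncomputable section

namespace QSeries

/-- The infinite `q`-shifted factorial `(a; q)_∞ = ∏_{k ≥ 0} (1 - a q^k)`. -/
def qPochInf (a q : ℂ) : ℂ := ∏' k : ℕ, (1 - a * q ^ k)

/-- The `n`-th term `q^(n²) / ((1 + a q + q²)(1 + a q² + q⁴) ⋯ (1 + a qⁿ + q²ⁿ))`
of the series defining `f_a(q)`. -/
def fTerm (a : ℝ) (q : ℂ) (n : ℕ) : ℂ :=
  q ^ (n ^ 2) / ∏ k ∈ Finset.Icc 1 n, (1 + (a : ℂ) * q ^ k + q ^ (2 * k))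

/-- `f_a(q) = ∑_{n ≥ 0} q^(n²) / ((1 + a q + q²) ⋯ (1 + a qⁿ + q²ⁿ))`. -/
def f (a : ℝ) (q : ℂ) : ℂ := ∑' n : ℕ, fTerm a q n

/-- Ramanujan's theta function `ψ(q) = ∑_{n ≥ 0} q^(n(n+1)/2)`. -/
def psi (q : ℂ) : ℂ := ∑' n : ℕ, q ^ (n + 1).choose 2

end QSeries

end

/-!
Write `j(z; q) = (z; q)_∞ (q/z; q)_∞`. If `a = -(z + 1/z)`, then
`1 + a q ^ k + q ^ (2 k) = (1 - z q ^ k) (1 - q ^ k / z)`, so `f_a(q)` is the rank generating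
function at `z`. Multiplied by `(z q; q)_∞ (q/z; q)_∞`, it becomes a series `K(z; q)` (`rankSum`)
that is holomorphic in `z ≠ 0`, and a telescoping argument gives the `q`-difference equation
`K(z q) = q z² K(z) + (1 - q z²) j(z q)` (`rankSum_mul`).

With `x = e^(iπ/3)`, the three functions of the theorem are the values at `x` and `-x` in base `-q`,
and at `i x` in base `q`. For an arbitrary `x`, one combination of these three functions, over a
common denominator, satisfies the homogeneous equation `E(x q) = q E(x)` (`rankCombination_mul`).
Hence `E(x) / x` is a `q`-periodic holomorphic function on the punctured plane, that is, a
constant (`eq_mul_of_q_difference`), and the constant is read off at `x = 1`, where two of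
the three terms vanish. The remaining one is evaluated by Durfee's identity (`rankSum_one`) and
Gauss's product for `ψ` (`psi_eq`), each of which follows from a one-parameter family of series
whose neighbouring members are related by telescoping.
-/

namespace QSeries

open Filter Topology

/-! ### The `q`-shifted factorial -/

lemma summable_norm_mul_pow {q : ℂ} (hq : ‖q‖ < 1) (a : ℂ) :
    Summable fun k : ℕ => ‖-(a * q ^ k)‖ := by
  simpa using (summable_geometric_of_lt_one (norm_nonneg q) hq).mul_left ‖a‖

lemma multipliable_one_sub_mul_pow {q : ℂ} (hq : ‖q‖ < 1) (a : ℂ) :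
    Multipliable fun k : ℕ => 1 - a * q ^ k := by
  simpa [sub_eq_add_neg] using multipliable_one_add_of_summable (summable_norm_mul_pow hq a)

lemma qPochInf_eq_prod_mul {q : ℂ} (hq : ‖q‖ < 1) (a : ℂ) (n : ℕ) :
    qPochInf a q = (∏ k ∈ Finset.range n, (1 - a * q ^ k)) * qPochInf (a * q ^ n) q := by
  have h : ∀ k, 1 - a * q ^ n * q ^ k = 1 - a * q ^ (k + n) := fun k => by ring
  simp only [qPochInf, h]
  refine (Multipliable.prod_mul_tprod_nat_mul' (f := fun k => 1 - a * q ^ k) ?_).symm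
  simpa [h] using multipliable_one_sub_mul_pow hq (a * q ^ n)

lemma qPochInf_eq_mul {q : ℂ} (hq : ‖q‖ < 1) (a : ℂ) :
    qPochInf a q = (1 - a) * qPochInf (a * q) q := by
  simpa using qPochInf_eq_prod_mul hq a 1

lemma qPochInf_mul_pow {q : ℂ} (hq : ‖q‖ < 1) (a : ℂ) (n : ℕ) :
    qPochInf (a * q ^ n) q = (1 - a * q ^ n) * qPochInf (a * q ^ (n + 1)) q := by
  rw [qPochInf_eq_mul hq, pow_succ, mul_assoc a]

@[simp]
lemma qPochInf_zero_left (q : ℂ) : qPochInf 0 q = 1 := by simp [qPochInf]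

lemma qPochInf_one {q : ℂ} (hq : ‖q‖ < 1) : qPochInf 1 q = 0 := by
  rw [qPochInf_eq_mul hq]; simp

lemma norm_prod_one_sub_le {q : ℂ} (hq : ‖q‖ < 1) (a : ℂ) (n : ℕ) :
    ‖∏ k ∈ Finset.range n, (1 - a * q ^ k)‖ ≤ Real.exp (‖a‖ / (1 - ‖q‖)) := by
  calc ‖∏ k ∈ Finset.range n, (1 - a * q ^ k)‖
      ≤ ∏ k ∈ Finset.range n, (1 + ‖a‖ * ‖q‖ ^ k) := by
        rw [norm_prod]
        refine Finset.prod_le_prod (fun _ _ => norm_nonneg _) fun k _ => ?_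
        simpa using norm_sub_le 1 (a * q ^ k)
    _ ≤ Real.exp (∑ k ∈ Finset.range n, ‖a‖ * ‖q‖ ^ k) :=
        Real.prod_one_add_le_exp_sum _ fun _ => by positivity
    _ ≤ Real.exp (‖a‖ / (1 - ‖q‖)) := by
        rw [Real.exp_le_exp, ← Finset.mul_sum, div_eq_mul_inv]
        gcongr
        rw [← tsum_geometric_of_lt_one (norm_nonneg q) hq]
        exact (summable_geometric_of_lt_one (norm_nonneg q) hq).sum_le_tsum _
          fun _ _ => by positivity

lemma norm_qPochInf_le {q : ℂ} (hq : ‖q‖ < 1) (a : ℂ) :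
    ‖qPochInf a q‖ ≤ Real.exp (‖a‖ / (1 - ‖q‖)) :=
  le_of_tendsto ((multipliable_one_sub_mul_pow hq a).hasProd.tendsto_prod_nat.norm)
    (Eventually.of_forall fun n => norm_prod_one_sub_le hq a n)

lemma differentiable_qPochInf {q : ℂ} (hq : ‖q‖ < 1) :
    Differentiable ℂ fun a => qPochInf a q := by
  intro a
  have hU : IsOpen (Metric.ball (0 : ℂ) (‖a‖ + 1)) := Metric.isOpen_ball
  have h : HasProdLocallyUniformlyOn (fun (k : ℕ) (a : ℂ) => 1 + -(a * q ^ k))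
      (fun a => ∏' k : ℕ, (1 + -(a * q ^ k))) (Metric.ball (0 : ℂ) (‖a‖ + 1)) := by
    refine Summable.hasProdLocallyUniformlyOn_nat_one_add hU
      (u := fun k => (‖a‖ + 1) * ‖q‖ ^ k)
      ((summable_geometric_of_lt_one (norm_nonneg q) hq).mul_left _)
      (Eventually.of_forall fun n x hx => ?_) fun n => by fun_prop
    rw [norm_neg, norm_mul, norm_pow]
    have : ‖x‖ ≤ ‖a‖ + 1 := by simpa using (mem_ball_zero_iff.1 hx).le
    gcongr
  rw [hasProdLocallyUniformlyOn_iff_tendstoLocallyUniformlyOn] at h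
  have h2 := (h.differentiableOn (Eventually.of_forall fun s => by fun_prop) hU).differentiableAt
    (hU.mem_nhds (by simp : a ∈ Metric.ball (0 : ℂ) (‖a‖ + 1)))
  simpa [qPochInf, sub_eq_add_neg] using h2

lemma qPochInf_ne_zero {q : ℂ} (hq : ‖q‖ < 1) {a : ℂ} (ha : ∀ k : ℕ, a * q ^ k ≠ 1) :
    qPochInf a q ≠ 0 := by
  have := tprod_one_add_ne_zero_of_summable (f := fun k : ℕ => -(a * q ^ k))
    (fun k h => ha k (by linear_combination -h)) (summable_norm_mul_pow hq a)
  simpa [qPochInf, sub_eq_add_neg] using this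

lemma mul_pow_ne_one {q : ℂ} (hq : ‖q‖ < 1) {a : ℂ} (ha : ‖a‖ < 1) (k : ℕ) :
    a * q ^ k ≠ 1 := by
  intro h
  have h1 : ‖a‖ * ‖q‖ ^ k = 1 := by simpa using congrArg norm h
  have h2 : ‖a‖ * ‖q‖ ^ k ≤ ‖a‖ := mul_le_of_le_one_right (norm_nonneg _)
    (pow_le_one₀ (norm_nonneg _) hq.le)
  linarith

lemma qPochInf_ne_zero_of_norm_lt_one {q : ℂ} (hq : ‖q‖ < 1) {a : ℂ} (ha : ‖a‖ < 1) :
    qPochInf a q ≠ 0 :=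
  qPochInf_ne_zero hq (mul_pow_ne_one hq ha)

lemma norm_pow_lt_one {q : ℂ} (hq : ‖q‖ < 1) {n : ℕ} (hn : n ≠ 0) : ‖q ^ n‖ < 1 := by
  rw [norm_pow]; exact pow_lt_one₀ (norm_nonneg _) hq hn

lemma qPochInf_mul_qPochInf_neg {q : ℂ} (hq : ‖q‖ < 1) (a : ℂ) :
    qPochInf a q * qPochInf (-a) q = qPochInf (a ^ 2) (q ^ 2) := by
  rw [qPochInf, qPochInf, ← (multipliable_one_sub_mul_pow hq a).tprod_mul
    (multipliable_one_sub_mul_pow hq (-a)), qPochInf]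
  exact tprod_congr fun k => by ring

lemma qPochInf_eq_even_mul_odd {q : ℂ} (hq : ‖q‖ < 1) (a : ℂ) :
    qPochInf a q = qPochInf a (q ^ 2) * qPochInf (a * q) (q ^ 2) := by
  have h0 : ∀ k, 1 - a * (q ^ 2) ^ k = 1 - a * q ^ (2 * k) := fun k => by ring
  have h1 : ∀ k, 1 - a * q * (q ^ 2) ^ k = 1 - a * q ^ (2 * k + 1) := fun k => by ring
  have hq2 := norm_pow_lt_one hq two_ne_zero
  have m0 := multipliable_one_sub_mul_pow hq2 a
  have m1 := multipliable_one_sub_mul_pow hq2 (a * q)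
  simp only [h0] at m0
  simp only [h1] at m1
  simp only [qPochInf, h0, h1]
  exact (tprod_even_mul_odd (f := fun k => 1 - a * q ^ k) m0 m1).symm

/-- The factors of `(x; -q)_∞ (-x; -q)_∞` are those of `(x; q)_∞ (-x; q)_∞`, rearranged. -/
lemma qPochInf_mul_qPochInf_neg_neg {q : ℂ} (hq : ‖q‖ < 1) (a : ℂ) :
    qPochInf a (-q) * qPochInf (-a) (-q) = qPochInf (a ^ 2) (q ^ 2) := by
  rw [qPochInf_mul_qPochInf_neg (by simpa using hq), neg_sq]

/-- Grouping the three factors `1 - a q ^ k`, `1 - ω a q ^ k`, `1 - ω² a q ^ k`, where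
`ω` is a primitive cube root of unity. -/
lemma qPochInf_mul_cube_root {q : ℂ} (hq : ‖q‖ < 1) {ω : ℂ} (hω : ω ^ 2 + ω + 1 = 0) (a : ℂ) :
    qPochInf a q * (qPochInf (ω * a) q * qPochInf (ω ^ 2 * a) q) = qPochInf (a ^ 3) (q ^ 3) := by
  have m := fun b => multipliable_one_sub_mul_pow hq b
  simp only [qPochInf]
  rw [← (m (ω * a)).tprod_mul (m (ω ^ 2 * a)),
    ← (m a).tprod_mul ((m (ω * a)).mul (m (ω ^ 2 * a)))]
  refine tprod_congr fun k => ?_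
  have h3 : ω ^ 3 = 1 := by linear_combination (ω - 1) * hω
  rw [← pow_mul, mul_comm 3 k, pow_mul]
  generalize q ^ k = y
  linear_combination (-(a * y) + ω * (a * y) ^ 2) * hω - (a * y) ^ 3 * h3

lemma summable_pow_sq {r : ℝ} (hr0 : 0 ≤ r) (hr : r < 1) : Summable fun n : ℕ => r ^ (n ^ 2) :=
  Summable.of_nonneg_of_le (fun _ => by positivity)
    (fun n => pow_le_pow_of_le_one hr0 hr.le (Nat.le_self_pow two_ne_zero n))
    (summable_geometric_of_lt_one hr0 hr)

lemma le_choose_succ_two (n : ℕ) : n ≤ (n + 1).choose 2 := by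
  rw [Nat.choose_succ_succ' n 1]; simp

lemma summable_pow_choose {r : ℝ} (hr0 : 0 ≤ r) (hr : r < 1) :
    Summable fun n : ℕ => r ^ (n + 1).choose 2 :=
  Summable.of_nonneg_of_le (fun _ => by positivity)
    (fun n => pow_le_pow_of_le_one hr0 hr.le (le_choose_succ_two n))
    (summable_geometric_of_lt_one hr0 hr)

lemma tsum_eq_tsum_add_of_telescoping {s t c : ℕ → ℂ} (hs : Summable s) (ht : Summable t)
    (hc : Summable c) (h : ∀ n, s n - t n = c (n + 1) - c n) :
    ∑' n, s n = ∑' n, t n - c 0 := by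
  have h1 : ∑' n, (s n - t n) = ∑' n, (c (n + 1) - c n) := tsum_congr h
  rw [hs.tsum_sub ht, ((summable_nat_add_iff 1).2 hc).tsum_sub hc, hc.tsum_eq_zero_add] at h1
  linear_combination h1

/-! ### Gauss's product for `ψ` -/

/-- The series `∑ (b; q)_n q^(n(n+1)/2) (q^(n+1); q)_∞`, which is `(q; q)_∞` times the left-hand
side of Lebesgue's identity. -/
noncomputable def lebesgueSum (b q : ℂ) : ℂ :=
  ∑' n : ℕ, (∏ k ∈ Finset.range n, (1 - b * q ^ k)) * q ^ (n + 1).choose 2 *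
    qPochInf (q * q ^ n) q

lemma norm_mul_pow_le {q : ℂ} (hq : ‖q‖ < 1) (a : ℂ) (n : ℕ) : ‖a * q ^ n‖ ≤ ‖a‖ := by
  rw [norm_mul, norm_pow]
  exact mul_le_of_le_one_right (norm_nonneg _) (pow_le_one₀ (norm_nonneg _) hq.le)

lemma norm_qPochInf_mul_pow_le {q : ℂ} (hq : ‖q‖ < 1) (a : ℂ) (n : ℕ) :
    ‖qPochInf (a * q ^ n) q‖ ≤ Real.exp (‖a‖ / (1 - ‖q‖)) := by
  refine (norm_qPochInf_le hq _).trans (Real.exp_le_exp.2 ?_)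
  have := norm_mul_pow_le hq a n
  have : 0 < 1 - ‖q‖ := by linarith
  gcongr

/-- The bound depends on `b` only through `‖b‖`, and on `n` not at all, so that it also serves for
dominated convergence. -/
lemma norm_lebesgueSum_term_le {q : ℂ} (hq : ‖q‖ < 1) (b : ℂ) (n m : ℕ) :
    ‖(∏ k ∈ Finset.range n, (1 - b * q ^ k)) * q ^ m * qPochInf (q * q ^ n) q‖ ≤
      Real.exp (‖b‖ / (1 - ‖q‖)) * ‖q‖ ^ m * Real.exp (‖q‖ / (1 - ‖q‖)) := by
  rw [norm_mul, norm_mul, norm_pow]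
  gcongr
  · exact norm_prod_one_sub_le hq b n
  · exact norm_qPochInf_mul_pow_le hq q n

lemma summable_lebesgueSum {q : ℂ} (hq : ‖q‖ < 1) (b : ℂ) :
    Summable fun n : ℕ => (∏ k ∈ Finset.range n, (1 - b * q ^ k)) * q ^ (n + 1).choose 2 *
      qPochInf (q * q ^ n) q :=
  Summable.of_norm_bounded (((summable_pow_choose (norm_nonneg q) hq).mul_left _).mul_right _)
    fun n => norm_lebesgueSum_term_le hq b n _

lemma lebesgueSum_eq_mul {q : ℂ} (hq : ‖q‖ < 1) (b : ℂ) :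
    lebesgueSum b q = (1 - b * q) * lebesgueSum (b * q ^ 2) q := by
  -- The differences of the terms of the two sides telescope to `c`.
  let c : ℕ → ℂ := fun n => Nat.casesOn n 0 fun n =>
    b * ((∏ k ∈ Finset.range n, (1 - b * q * q ^ k)) * q ^ (n + 2).choose 2 *
      qPochInf (q * q ^ n) q)
  have hc : Summable c := by
    refine (summable_nat_add_iff 1).1 ?_
    refine Summable.mul_left b (Summable.of_norm_bounded
      (((((summable_nat_add_iff 1).2 (summable_pow_choose (norm_nonneg q) hq))).mul_left
        (Real.exp (‖b * q‖ / (1 - ‖q‖)))).mul_right (Real.exp (‖q‖ / (1 - ‖q‖))))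
      fun n => norm_lebesgueSum_term_le hq (b * q) n _)
  have h := tsum_eq_tsum_add_of_telescoping (summable_lebesgueSum hq b)
    ((summable_lebesgueSum hq (b * q ^ 2)).mul_left (1 - b * q)) hc fun n => ?_
  · rw [lebesgueSum, h, tsum_mul_left, lebesgueSum]
    simp [c]
  · cases n with
    | zero => simp [c]; ring
    | succ n =>
      have e1 : (n + 2).choose 2 = (n + 1).choose 2 + (n + 1) := by
        rw [Nat.choose_succ_succ' (n + 1) 1]; simp [add_comm]
      have e2 : (n + 3).choose 2 = (n + 1).choose 2 + (n + 1) + (n + 2) := by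
        rw [Nat.choose_succ_succ' (n + 2) 1, e1]; simp; ring
      have p1 : (∏ k ∈ Finset.range (n + 1), (1 - b * q ^ k)) =
          (1 - b) * ∏ k ∈ Finset.range n, (1 - b * q * q ^ k) := by
        rw [Finset.prod_range_succ', mul_comm]
        simp only [pow_zero, mul_one, pow_succ']
        simp only [mul_assoc]
      have p2 : (1 - b * q) * (∏ k ∈ Finset.range (n + 1), (1 - b * q ^ 2 * q ^ k)) =
          (∏ k ∈ Finset.range n, (1 - b * q * q ^ k)) * (1 - b * q * q ^ n) *
            (1 - b * q * q ^ (n + 1)) := by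
        rw [← Finset.prod_range_succ, ← Finset.prod_range_succ, Finset.prod_range_succ' _ (n + 1),
          mul_comm, pow_zero, mul_one]
        congr 1
        exact Finset.prod_congr rfl fun k _ => by ring
      have p3 : (∏ k ∈ Finset.range (n + 1), (1 - b * q * q ^ k)) =
          (∏ k ∈ Finset.range n, (1 - b * q * q ^ k)) * (1 - b * q * q ^ n) :=
        Finset.prod_range_succ _ _
      have p4 := qPochInf_mul_pow hq q n
      simp only [c]
      rw [← mul_assoc, ← mul_assoc, p2, p1, p3, p4, e2, e1]
      ring

lemma lebesgueSum_eq_prod_mul {q : ℂ} (hq : ‖q‖ < 1) (b : ℂ) (n : ℕ) :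
    lebesgueSum b q = (∏ k ∈ Finset.range n, (1 - b * q * (q ^ 2) ^ k)) *
      lebesgueSum (b * (q ^ 2) ^ n) q := by
  induction n with
  | zero => simp
  | succ n ih =>
    rw [ih, lebesgueSum_eq_mul hq (b * (q ^ 2) ^ n), Finset.prod_range_succ]
    ring_nf

lemma tendsto_lebesgueSum {q : ℂ} (hq : ‖q‖ < 1) (b : ℂ) :
    Tendsto (fun n : ℕ => lebesgueSum (b * (q ^ 2) ^ n) q) atTop (𝓝 (lebesgueSum 0 q)) := by
  have hq2 := norm_pow_lt_one hq two_ne_zero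
  refine tendsto_tsum_of_dominated_convergence
    (bound := fun n => Real.exp (‖b‖ / (1 - ‖q‖)) * ‖q‖ ^ (n + 1).choose 2 *
      Real.exp (‖q‖ / (1 - ‖q‖)))
    (((summable_pow_choose (norm_nonneg q) hq).mul_left _).mul_right _) (fun m => ?_)
    (Eventually.of_forall fun n m => (norm_lebesgueSum_term_le hq _ m _).trans ?_)
  · have h0 : Tendsto (fun n : ℕ => b * (q ^ 2) ^ n) atTop (𝓝 0) := by
      simpa using (tendsto_pow_atTop_nhds_zero_of_norm_lt_one hq2).const_mul b
    have hcont : Continuous fun x : ℂ => (∏ k ∈ Finset.range m, (1 - x * q ^ k)) *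
      q ^ (m + 1).choose 2 * qPochInf (q * q ^ m) q := by fun_prop
    exact (hcont.tendsto 0).comp h0
  · have := norm_mul_pow_le hq2 b n
    have : 0 < 1 - ‖q‖ := by linarith
    gcongr

/-- Lebesgue's identity, up to the value `lebesgueSum 0 q`. -/
lemma lebesgueSum_eq_qPochInf_mul {q : ℂ} (hq : ‖q‖ < 1) (b : ℂ) :
    lebesgueSum b q = qPochInf (b * q) (q ^ 2) * lebesgueSum 0 q := by
  refine tendsto_nhds_unique tendsto_const_nhds (Tendsto.congr
    (fun n => (lebesgueSum_eq_prod_mul hq b n).symm)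
    (((multipliable_one_sub_mul_pow (norm_pow_lt_one hq two_ne_zero)
      (b * q)).hasProd.tendsto_prod_nat).mul (tendsto_lebesgueSum hq b)))

lemma lebesgueSum_one {q : ℂ} (hq : ‖q‖ < 1) : lebesgueSum 1 q = qPochInf q q := by
  rw [lebesgueSum, (summable_lebesgueSum hq 1).tsum_eq_zero_add]
  simp [Finset.prod_range_succ']

lemma lebesgueSum_self {q : ℂ} (hq : ‖q‖ < 1) : lebesgueSum q q = qPochInf q q * psi q := by
  rw [lebesgueSum, psi, ← tsum_mul_left]
  refine tsum_congr fun n => ?_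
  rw [qPochInf_eq_prod_mul hq q n]
  ring

/-- Gauss's product for `ψ`, obtained from Lebesgue's identity at `b = 1`, where the series has
a single term, and at `b = q`. -/
lemma psi_eq {q : ℂ} (hq : ‖q‖ < 1) : psi q = qPochInf q q * qPochInf (-q) q ^ 2 := by
  have h1 := lebesgueSum_eq_qPochInf_mul hq 1
  have h2 := lebesgueSum_eq_qPochInf_mul hq q
  rw [lebesgueSum_one hq, one_mul] at h1
  rw [lebesgueSum_self hq, ← pow_two] at h2
  have h3 := qPochInf_mul_qPochInf_neg hq q
  have h4 := qPochInf_eq_even_mul_odd hq q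
  rw [← pow_two] at h4
  have hP := qPochInf_ne_zero_of_norm_lt_one hq hq
  have hodd : qPochInf q (q ^ 2) ≠ 0 := fun h => hP (by rw [h4, h, zero_mul])
  have hL : lebesgueSum 0 q ≠ 0 := fun h => hP (by rw [h1, h, mul_zero])
  have h5 : qPochInf q (q ^ 2) * psi q = qPochInf (q ^ 2) (q ^ 2) := by
    apply mul_right_cancel₀ hL
    linear_combination h2 - psi q * h1
  have h6 : qPochInf q (q ^ 2) * qPochInf (-q) q = 1 := by
    have hE : qPochInf (q ^ 2) (q ^ 2) ≠ 0 := fun h => hP (by rw [h4, h, mul_zero])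
    apply mul_right_cancel₀ hE
    rw [h4] at h3
    linear_combination h3
  apply mul_left_cancel₀ hodd
  linear_combination h5 - h3 - qPochInf q q * qPochInf (-q) q * h6

lemma summable_psi {q : ℂ} (hq : ‖q‖ < 1) : Summable fun n : ℕ => q ^ (n + 1).choose 2 :=
  Summable.of_norm (by simpa using summable_pow_choose (norm_nonneg q) hq)

/-! ### The rank generating function, with denominators cleared -/

/-- The theta function `j(z; q) = (z; q)_∞ (q/z; q)_∞`. -/
noncomputable def theta (z q : ℂ) : ℂ := qPochInf z q * qPochInf (q / z) q

/-- The series `∑ q^(n²) (z q^(n+1); q)_∞ (q^(n+1)/z; q)_∞`: the rank generating function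
`∑ q^(n²) / ((z q; q)_n (q/z; q)_n)` multiplied by `(z q; q)_∞ (q/z; q)_∞`. Unlike that function,
it has no poles in `z ≠ 0`. -/
noncomputable def rankSum (z q : ℂ) : ℂ :=
  ∑' n : ℕ, q ^ (n ^ 2) * qPochInf (z * q * q ^ n) q * qPochInf (q / z * q ^ n) q

lemma theta_mul {q z : ℂ} (hq : ‖q‖ < 1) (hq0 : q ≠ 0) (hz : z ≠ 0) :
    z * theta (z * q) q = -theta z q := by
  rw [theta, theta, div_mul_cancel_right₀ hq0, qPochInf_eq_mul hq z, qPochInf_eq_mul hq z⁻¹,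
    inv_mul_eq_div]
  linear_combination -qPochInf (z * q) q * qPochInf (q / z) q * mul_inv_cancel₀ hz

lemma norm_rankSum_term_le {q : ℂ} (hq : ‖q‖ < 1) (a b : ℂ) {n e : ℕ} (he : n ^ 2 ≤ e) (k m : ℕ) :
    ‖q ^ e * qPochInf (a * q ^ k) q * qPochInf (b * q ^ m) q‖ ≤
      ‖q‖ ^ (n ^ 2) * (Real.exp (‖a‖ / (1 - ‖q‖)) * Real.exp (‖b‖ / (1 - ‖q‖))) := by
  have h1 := norm_qPochInf_mul_pow_le hq a k
  have h2 := norm_qPochInf_mul_pow_le hq b m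
  have h3 : ‖q‖ ^ e ≤ ‖q‖ ^ (n ^ 2) := pow_le_pow_of_le_one (norm_nonneg _) hq.le he
  rw [norm_mul, norm_mul, norm_pow, mul_assoc]
  gcongr

lemma summable_rankSum_term {q : ℂ} (hq : ‖q‖ < 1) (a b : ℂ) {e k m : ℕ → ℕ}
    (he : ∀ n, n ^ 2 ≤ e n) :
    Summable fun n : ℕ =>
      q ^ e n * qPochInf (a * q ^ k n) q * qPochInf (b * q ^ m n) q :=
  Summable.of_norm_bounded ((summable_pow_sq (norm_nonneg q) hq).mul_right _)
    fun n => norm_rankSum_term_le hq a b (he n) _ _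

/-- The `q`-difference equation of the rank generating function. -/
lemma rankSum_mul {q z : ℂ} (hq : ‖q‖ < 1) (hq0 : q ≠ 0) (hz : z ≠ 0) :
    rankSum (z * q) q = q * z ^ 2 * rankSum z q + (1 - q * z ^ 2) * theta (z * q) q := by
  have hS := fun a b : ℂ => summable_rankSum_term hq a b (e := fun n => n ^ 2) (k := fun n => n)
    (m := fun n => n) fun n => le_rfl
  -- The terms of `K(z q) - q z² K(z)` are the differences of
  -- `(q z² - 1) q^(n²) (z q^(n+1); q)_∞ (q^n/z; q)_∞`, which at `n = 0` is `(q z² - 1) j(z q)`.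
  have h := tsum_eq_tsum_add_of_telescoping (hS (z * q * q) (q / (z * q)))
    ((hS (z * q) (q / z)).mul_left (q * z ^ 2))
    ((hS (z * q) z⁻¹).mul_left (q * z ^ 2 - 1)) fun n => ?_
  · rw [rankSum, h, tsum_mul_left, rankSum, theta, div_mul_cancel_right₀ hq0]
    simp
    ring
  · have h1 := qPochInf_mul_pow hq (z * q) n
    have h2 := qPochInf_mul_pow hq z⁻¹ n
    have e1 : z * q * q * q ^ n = z * q * q ^ (n + 1) := by ring
    have e2 : q / z * q ^ n = z⁻¹ * q ^ (n + 1) := by rw [div_eq_mul_inv]; ring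
    rw [div_mul_cancel_right₀ hq0, e1, e2, h1, h2,
      show q ^ ((n + 1) ^ 2) = q ^ (n ^ 2) * (q ^ n) ^ 2 * q by ring]
    generalize qPochInf (z * q * q ^ (n + 1)) q = A
    generalize qPochInf (z⁻¹ * q ^ (n + 1)) q = B
    have e3 : z * z⁻¹ = 1 := mul_inv_cancel₀ hz
    generalize q ^ (n ^ 2) = C
    generalize q ^ n = y
    generalize z⁻¹ = w at *
    linear_combination (C * A * B * (-q * z * y + (q * z ^ 2 - 1) * q * y ^ 2)) * e3

/-- Durfee's identity `∑ q^(n²) / (q; q)_n² = 1 / (q; q)_∞`, multiplied by `(q; q)_∞²`. -/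
lemma rankSum_one {q : ℂ} (hq : ‖q‖ < 1) : rankSum 1 q = qPochInf q q := by
  -- `L m / (q; q)_∞` is the series obtained from `n × (n + m)` Durfee rectangles, multiplied by
  -- `(q; q)_∞`; it does not depend on `m`.
  let L : ℕ → ℂ := fun m => ∑' n : ℕ,
    q ^ (n ^ 2 + m * n) * qPochInf (q * q ^ n) q * qPochInf (q * q ^ (n + m)) q
  have hstep : ∀ m, L m = L (m + 1) := by
    intro m
    have h := tsum_eq_tsum_add_of_telescoping
      (summable_rankSum_term hq q q (e := fun n => n ^ 2 + m * n) (k := fun n => n)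
        (m := fun n => n + m) fun n => Nat.le_add_right _ _)
      (summable_rankSum_term hq q q (e := fun n => n ^ 2 + (m + 1) * n) (k := fun n => n)
        (m := fun n => n + (m + 1)) fun n => Nat.le_add_right _ _)
      (summable_rankSum_term hq 1 q (e := fun n => n ^ 2 + m * n) (k := fun n => n)
        (m := fun n => n + m) fun n => Nat.le_add_right _ _).neg fun n => ?_
    · simpa [L, qPochInf_one hq] using h
    · have h1 := qPochInf_mul_pow hq 1 n
      have h2 := qPochInf_mul_pow hq q (n + m)
      rw [h1, show n + 1 + m = n + m + 1 by ring, show n + (m + 1) = n + m + 1 by ring, h2,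
        one_mul, one_mul, pow_succ' q n]
      ring
  have hL : ∀ m, L m = L 0 := fun m => by
    induction m with
    | zero => rfl
    | succ m ih => rw [← hstep, ih]
  -- As `m → ∞` only the term `n = 0` survives.
  have hlim : Tendsto L atTop (𝓝 (∑' n : ℕ, if n = 0 then qPochInf q q else 0)) := by
    refine tendsto_tsum_of_dominated_convergence ((summable_pow_sq (norm_nonneg q) hq).mul_right
      (Real.exp (‖q‖ / (1 - ‖q‖)) * Real.exp (‖q‖ / (1 - ‖q‖)))) (fun n => ?_)
      (Eventually.of_forall fun m n => norm_rankSum_term_le hq q q (Nat.le_add_right _ _) _ _)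
    have hpow := tendsto_pow_atTop_nhds_zero_of_norm_lt_one hq
    have hP : Tendsto (fun m : ℕ => qPochInf (q * q ^ (n + m)) q) atTop (𝓝 1) := by
      have h0 : Tendsto (fun m : ℕ => q * q ^ (n + m)) atTop (𝓝 0) := by
        simpa [pow_add] using (hpow.const_mul (q ^ n)).const_mul q
      simpa [Function.comp_def] using
        ((differentiable_qPochInf hq).continuous.tendsto 0).comp h0
    rcases eq_or_ne n 0 with rfl | hn
    · simpa using hP.const_mul (qPochInf q q)
    · have h1 : Tendsto (fun m : ℕ => q ^ (n ^ 2 + m * n)) atTop (𝓝 0) := by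
        simpa [pow_add, pow_mul, mul_comm _ n] using
          (tendsto_pow_atTop_nhds_zero_of_norm_lt_one (norm_pow_lt_one hq hn)).const_mul
            (q ^ n ^ 2)
      simpa [hn] using (h1.mul_const (qPochInf (q * q ^ n) q)).mul hP
  have h := tendsto_nhds_unique (hlim.congr hL) tendsto_const_nhds
  rw [tsum_ite_eq] at h
  rw [h]
  simp [L, rankSum]

lemma differentiableOn_rankSum {q : ℂ} (hq : ‖q‖ < 1) :
    DifferentiableOn ℂ (fun z => rankSum z q) {0}ᶜ := by
  intro z hz
  have hz0 : 0 < ‖z‖ := norm_pos_iff.2 hz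
  let U : Set ℂ := {w | ‖z‖ / 2 < ‖w‖ ∧ ‖w‖ < ‖z‖ + 1}
  have hU : IsOpen U := (isOpen_lt continuous_const continuous_norm).inter
    (isOpen_lt continuous_norm continuous_const)
  have hzU : z ∈ U := ⟨by linarith, by linarith⟩
  have hd := differentiable_qPochInf hq
  have hq1 : 0 < 1 - ‖q‖ := by linarith
  refine DifferentiableAt.differentiableWithinAt (DifferentiableOn.differentiableAt
    (s := U) ?_ (hU.mem_nhds hzU))
  refine Complex.differentiableOn_tsum_of_summable_norm
    ((summable_pow_sq (norm_nonneg q) hq).mul_right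
      (Real.exp ((‖z‖ + 1) * ‖q‖ / (1 - ‖q‖)) * Real.exp (‖q‖ / (‖z‖ / 2) / (1 - ‖q‖))))
    (fun n w hw => ?_) hU fun n w hw => ?_
  · have hw0 : w ≠ 0 := norm_pos_iff.1 (by linarith [hw.1])
    have h1 : DifferentiableAt ℂ (fun w => qPochInf (w * q * q ^ n) q) w :=
      (hd _).comp w (by fun_prop)
    have h2 : DifferentiableAt ℂ (fun w => qPochInf (q / w * q ^ n) q) w :=
      (hd _).comp w (by fun_prop (disch := assumption))
    exact ((h1.const_mul _).mul h2).differentiableWithinAt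
  · refine (norm_rankSum_term_le hq (w * q) (q / w) le_rfl n n).trans ?_
    have h1 := hw.1
    have h2 := hw.2
    rw [norm_mul, norm_div]
    gcongr

lemma differentiableOn_theta {q : ℂ} (hq : ‖q‖ < 1) :
    DifferentiableOn ℂ (fun z => theta z q) {0}ᶜ := by
  intro z hz
  have hz0 : z ≠ 0 := hz
  have hd := differentiable_qPochInf hq
  have h2 : DifferentiableAt ℂ (fun w => qPochInf (q / w) q) z :=
    (hd _).comp z (by fun_prop (disch := assumption))
  exact ((hd z).mul h2).differentiableWithinAt

/-- A holomorphic function on the punctured plane with `E (x q) = q E x` is linear: `E x / x` is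
bounded near `0`, so it extends continuously to `0`, and it takes at `x` the same value as at
`x q ^ n → 0`. -/
lemma eq_mul_of_q_difference {E : ℂ → ℂ} {q : ℂ} (hq : ‖q‖ < 1) (hq0 : q ≠ 0)
    (hE : DifferentiableOn ℂ E {0}ᶜ) (h : ∀ x, x ≠ 0 → E (x * q) = q * E x) {x : ℂ}
    (hx : x ≠ 0) : E x = x * E 1 := by
  let F : ℂ → ℂ := fun x => E x / x
  have hF : ∀ x, x ≠ 0 → ∀ n : ℕ, F (x * q ^ n) = F x := by
    intro x hx n
    induction n with
    | zero => simp
    | succ n ih =>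
      have hxn : x * q ^ n ≠ 0 := mul_ne_zero hx (pow_ne_zero n hq0)
      rw [← ih]
      simp only [F]
      rw [pow_succ, ← mul_assoc, h _ hxn]
      field_simp
  have hFd : DifferentiableOn ℂ F {0}ᶜ := hE.div differentiableOn_id fun x hx => hx
  have hcompact : IsCompact (Metric.closedBall (0 : ℂ) 1 \ Metric.ball 0 ‖q‖) :=
    (isCompact_closedBall 0 1).diff Metric.isOpen_ball
  have hqpos : 0 < ‖q‖ := norm_pos_iff.2 hq0
  obtain ⟨C, hC⟩ := hcompact.exists_bound_of_continuousOn (f := F)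
    (hFd.continuousOn.mono fun y hy (hy0 : y = 0) => hy.2 (by simpa [hy0] using hqpos))
  have hbound : ∀ y, y ≠ 0 → ‖y‖ ≤ 1 → ‖F y‖ ≤ C := by
    intro y hy hy1
    obtain ⟨n, hn1, hn2⟩ := exists_nat_pow_near_of_lt_one (norm_pos_iff.2 hy) hy1 hqpos hq
    have hqn : q ^ n ≠ 0 := pow_ne_zero n hq0
    have hqn' : 0 < ‖q‖ ^ n := by positivity
    rw [show y = y / q ^ n * q ^ n by field_simp, hF _ (div_ne_zero hy hqn)]
    refine hC _ ⟨?_, ?_⟩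
    · rw [mem_closedBall_zero_iff, norm_div, norm_pow]
      exact div_le_one_of_le₀ hn2 hqn'.le
    · rw [mem_ball_zero_iff, norm_div, norm_pow, not_lt, le_div_iff₀ hqn', ← pow_succ']
      exact hn1.le
  have hlim := Complex.tendsto_limUnder_of_differentiable_on_punctured_nhds_of_bounded_under
    (f := F) (c := 0)
    (eventually_mem_nhdsWithin.mono fun z hz => hFd.differentiableAt
      (isOpen_compl_singleton.mem_nhds hz))
    (isBoundedUnder_of_eventually_le (a := C + ‖F 0‖) (by
      filter_upwards [eventually_mem_nhdsWithin,
        mem_nhdsWithin_of_mem_nhds (Metric.closedBall_mem_nhds (0 : ℂ) one_pos)] with z hz hz1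
      exact (norm_sub_le _ _).trans
        (by gcongr; exact hbound z hz (mem_closedBall_zero_iff.1 hz1))))
  have hconst : ∀ y, y ≠ 0 → F y = (𝓝[≠] 0).limUnder F := by
    intro y hy
    have ht : Tendsto (fun n : ℕ => y * q ^ n) atTop (𝓝[≠] 0) :=
      tendsto_nhdsWithin_iff.2
        ⟨by simpa using (tendsto_pow_atTop_nhds_zero_of_norm_lt_one hq).const_mul y,
          Eventually.of_forall fun n => mul_ne_zero hy (pow_ne_zero n hq0)⟩
    exact tendsto_nhds_unique tendsto_const_nhds
      ((hlim.comp ht).congr fun n => hF y hy n)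
  have h1 : E x / x = E 1 / 1 := (hconst x hx).trans (hconst 1 one_ne_zero).symm
  rw [div_one, div_eq_iff hx] at h1
  rw [h1, mul_comm]

/-! ### The three-term relation -/

lemma theta_eq {q : ℂ} (hq : ‖q‖ < 1) (z : ℂ) :
    theta z q = (1 - z) * (qPochInf (z * q) q * qPochInf (q / z) q) := by
  rw [theta, qPochInf_eq_mul hq z, mul_assoc]

/-- The combination of rank generating functions of `x` and `-x` in base `-q`, and of `i x` in
base `q`, over a common denominator. The coefficients are those for which the inhomogeneous terms
of the `q`-difference equations cancel. -/
noncomputable def rankCombination (q x : ℂ) : ℂ :=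
  (1 - Complex.I) / 2 * rankSum x (-q) * theta (-x) (-q) * theta (Complex.I * x) q
    + (1 + Complex.I) / 2 * rankSum (-x) (-q) * theta x (-q) * theta (Complex.I * x) q
    - rankSum (Complex.I * x) q * theta x (-q) * theta (-x) (-q)

lemma rankCombination_mul {q x : ℂ} (hq : ‖q‖ < 1) (hq0 : q ≠ 0) (hx : x ≠ 0) :
    rankCombination q (x * q) = q * rankCombination q x := by
  have hnq : ‖-q‖ < 1 := by simpa using hq
  have hnq0 : -q ≠ 0 := neg_ne_zero.2 hq0
  have hnx : -x ≠ 0 := neg_ne_zero.2 hx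
  have hix : Complex.I * x ≠ 0 := mul_ne_zero Complex.I_ne_zero hx
  have hI := Complex.I_sq
  have k1 := rankSum_mul hnq hnq0 hnx
  have k2 := rankSum_mul hnq hnq0 hx
  have k3 := rankSum_mul hq hq0 hix
  have t1 := theta_mul hnq hnq0 hnx
  have t2 := theta_mul hnq hnq0 hx
  have t3 := theta_mul hq hq0 hix
  rw [neg_mul_neg] at k1 t1
  rw [mul_neg, ← neg_mul] at k2 t2
  rw [mul_assoc Complex.I x q] at k3 t3
  have t1' : theta (-x) (-q) = x * theta (x * q) (-q) := by linear_combination t1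
  have t2' : theta x (-q) = -x * theta (-x * q) (-q) := by linear_combination t2
  have t3' : theta (Complex.I * x) q = -(Complex.I * x) * theta (Complex.I * (x * q)) q := by
    linear_combination t3
  rw [rankCombination, rankCombination, ← neg_mul, k1, k2, k3, t1', t2', t3']
  generalize theta (x * q) (-q) = A
  generalize theta (-x * q) (-q) = B
  generalize theta (Complex.I * (x * q)) q = C
  generalize rankSum x (-q) = K1
  generalize rankSum (-x) (-q) = K2
  generalize rankSum (Complex.I * x) q = K3
  generalize Complex.I = i at *
  ring_nf
  simp only [hI]
  ring

lemma differentiableOn_rankCombination {q : ℂ} (hq : ‖q‖ < 1) :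
    DifferentiableOn ℂ (rankCombination q) {0}ᶜ := by
  have hnq : ‖-q‖ < 1 := by simpa using hq
  have hneg : Set.MapsTo (fun x : ℂ => -x) {0}ᶜ {0}ᶜ := fun x hx => neg_ne_zero.2 hx
  have hI : Set.MapsTo (fun x : ℂ => Complex.I * x) {0}ᶜ {0}ᶜ :=
    fun x hx => mul_ne_zero Complex.I_ne_zero hx
  have dneg : DifferentiableOn ℂ (fun x : ℂ => -x) {0}ᶜ := by fun_prop
  have dI : DifferentiableOn ℂ (fun x : ℂ => Complex.I * x) {0}ᶜ := by fun_prop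
  have r1 := differentiableOn_rankSum hnq
  have r2 := r1.comp dneg hneg
  have r3 := (differentiableOn_rankSum hq).comp dI hI
  have t1 := differentiableOn_theta hnq
  have t2 := t1.comp dneg hneg
  have t3 := (differentiableOn_theta hq).comp dI hI
  exact ((((r1.const_mul _).mul t2).mul t3).add (((r2.const_mul _).mul t1).mul t3)).sub
    ((r3.mul t1).mul t2)

lemma rankCombination_one {q : ℂ} (hq : ‖q‖ < 1) :
    rankCombination q 1 = -2 * Complex.I * psi (-q) * qPochInf (-q ^ 2) (q ^ 2) := by
  have hnq : ‖-q‖ < 1 := by simpa using hq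
  have h1 : theta 1 (-q) = 0 := by rw [theta, qPochInf_one hnq, zero_mul]
  have h2 : theta (-1) (-q) = 2 * qPochInf q (-q) ^ 2 := by
    rw [theta_eq hnq]; simp; ring
  have h3 : theta Complex.I q = (1 - Complex.I) * qPochInf (-q ^ 2) (q ^ 2) := by
    have h := qPochInf_mul_qPochInf_neg hq (Complex.I * q)
    rw [mul_pow, Complex.I_sq, neg_one_mul] at h
    rw [theta_eq hq, ← h, Complex.div_I, mul_comm q]
  rw [rankCombination, h1, mul_one, h2, h3, rankSum_one hnq, psi_eq hnq, neg_neg]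
  linear_combination qPochInf (-q) (-q) * qPochInf q (-q) ^ 2 * qPochInf (-q ^ 2) (q ^ 2) *
    Complex.I_sq

/-- The three-term relation, for all `x`. -/
lemma rankCombination_eq {q x : ℂ} (hq : ‖q‖ < 1) (hq0 : q ≠ 0) (hx : x ≠ 0) :
    rankCombination q x =
      x * (-2 * Complex.I * psi (-q) * qPochInf (-q ^ 2) (q ^ 2)) := by
  rw [eq_mul_of_q_difference hq hq0 (differentiableOn_rankCombination hq)
    (fun x hx => rankCombination_mul hq hq0 hx) hx, rankCombination_one hq]

/-! ### The functions `f_a` as rank generating functions -/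

section

variable {q z : ℂ} {a : ℝ}

lemma one_add_mul_add_sq (hz : ‖z‖ = 1) (ha : (a : ℂ) = -(z + z⁻¹)) (y : ℂ) :
    1 + (a : ℂ) * y + y ^ 2 = (1 - z * y) * (1 - y / z) := by
  have hz0 : z ≠ 0 := norm_pos_iff.1 (by simp [hz])
  rw [ha]
  field_simp
  ring

lemma one_add_mul_pow_add_pow (hz : ‖z‖ = 1) (ha : (a : ℂ) = -(z + z⁻¹)) (k : ℕ) :
    1 + (a : ℂ) * q ^ (k + 1) + q ^ (2 * (k + 1)) =
      (1 - z * q * q ^ k) * (1 - q / z * q ^ k) := by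
  rw [mul_comm 2, pow_mul, one_add_mul_add_sq hz ha]
  ring

lemma norm_mul_lt_one (hq : ‖q‖ < 1) (hz : ‖z‖ = 1) : ‖z * q‖ < 1 := by simpa [hz]

lemma norm_div_lt_one (hq : ‖q‖ < 1) (hz : ‖z‖ = 1) : ‖q / z‖ < 1 := by simpa [hz]

lemma one_add_mul_pow_add_pow_ne_zero (hq : ‖q‖ < 1) (hz : ‖z‖ = 1)
    (ha : (a : ℂ) = -(z + z⁻¹)) {n : ℕ} (hn : 1 ≤ n) :
    1 + (a : ℂ) * q ^ n + q ^ (2 * n) ≠ 0 := by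
  obtain ⟨k, rfl⟩ := Nat.exists_eq_add_of_le' hn
  rw [one_add_mul_pow_add_pow hz ha]
  exact mul_ne_zero (sub_ne_zero.2 (mul_pow_ne_one hq (norm_mul_lt_one hq hz) k).symm)
    (sub_ne_zero.2 (mul_pow_ne_one hq (norm_div_lt_one hq hz) k).symm)

lemma qPochInf_mul_qPochInf_div_ne_zero (hq : ‖q‖ < 1) (hz : ‖z‖ = 1) :
    qPochInf (z * q) q * qPochInf (q / z) q ≠ 0 :=
  mul_ne_zero (qPochInf_ne_zero_of_norm_lt_one hq (norm_mul_lt_one hq hz))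
    (qPochInf_ne_zero_of_norm_lt_one hq (norm_div_lt_one hq hz))

/-- The terms of `f_a(q)` are those of `rankSum z q`, divided by `(z q; q)_∞ (q/z; q)_∞`. -/
lemma fTerm_eq (hq : ‖q‖ < 1) (hz : ‖z‖ = 1) (ha : (a : ℂ) = -(z + z⁻¹)) (n : ℕ) :
    fTerm a q n = q ^ (n ^ 2) * qPochInf (z * q * q ^ n) q * qPochInf (q / z * q ^ n) q /
      (qPochInf (z * q) q * qPochInf (q / z) q) := by
  have hprod : ∏ k ∈ Finset.Icc 1 n, (1 + (a : ℂ) * q ^ k + q ^ (2 * k)) =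
      (∏ k ∈ Finset.range n, (1 - z * q * q ^ k)) *
        ∏ k ∈ Finset.range n, (1 - q / z * q ^ k) := by
    rw [← Finset.prod_mul_distrib, ← Finset.Ico_add_one_right_eq_Icc,
      Finset.prod_Ico_eq_prod_range]
    exact Finset.prod_congr rfl fun k _ => by rw [add_comm 1 k, one_add_mul_pow_add_pow hz ha]
  have hP := qPochInf_mul_qPochInf_div_ne_zero hq hz
  have h1 := qPochInf_eq_prod_mul hq (z * q) n
  have h2 := qPochInf_eq_prod_mul hq (q / z) n
  rw [h1, h2] at hP
  rw [fTerm, hprod, h1, h2]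
  simp only [mul_ne_zero_iff] at hP
  obtain ⟨⟨h3, h4⟩, h5, h6⟩ := hP
  rw [div_eq_div_iff (mul_ne_zero h3 h5) (mul_ne_zero (mul_ne_zero h3 h4) (mul_ne_zero h5 h6))]
  ring

lemma summable_fTerm (hq : ‖q‖ < 1) (hz : ‖z‖ = 1) (ha : (a : ℂ) = -(z + z⁻¹)) :
    Summable (fTerm a q) := by
  rw [funext (fTerm_eq hq hz ha)]
  exact (summable_rankSum_term hq (z * q) (q / z) fun n => le_rfl).div_const _

lemma rankSum_eq_mul_f (hq : ‖q‖ < 1) (hz : ‖z‖ = 1) (ha : (a : ℂ) = -(z + z⁻¹)) :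
    rankSum z q = qPochInf (z * q) q * qPochInf (q / z) q * f a q := by
  rw [f, tsum_congr (fTerm_eq hq hz ha), tsum_div_const, rankSum,
    mul_div_cancel₀ _ (qPochInf_mul_qPochInf_div_ne_zero hq hz)]

lemma hasProd_one_div (hq : ‖q‖ < 1) (hz : ‖z‖ = 1) (ha : (a : ℂ) = -(z + z⁻¹)) :
    HasProd (fun n : ℕ => 1 / (1 + (a : ℂ) * q ^ (n + 1) + q ^ (2 * (n + 1))))
      (qPochInf (z * q) q * qPochInf (q / z) q)⁻¹ := by
  have h := (multipliable_one_sub_mul_pow hq (z * q)).hasProd.mul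
    (multipliable_one_sub_mul_pow hq (q / z)).hasProd
  simp only [one_div, one_add_mul_pow_add_pow hz ha]
  exact h.inv₀ (qPochInf_mul_qPochInf_div_ne_zero hq hz)

end

/-- The primitive sixth root of unity `e^(iπ/3)`. -/
noncomputable def sixthRoot : ℂ := (1 + (√3 : ℝ) * Complex.I) / 2

lemma sqrt_three_sq : ((√3 : ℝ) : ℂ) ^ 2 = 3 := by
  rw [← Complex.ofReal_pow, Real.sq_sqrt (by norm_num)]; norm_num

lemma sixthRoot_sq : sixthRoot ^ 2 = sixthRoot - 1 := by
  rw [sixthRoot]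
  linear_combination (1 / 4 : ℂ) * (Complex.I ^ 2 * sqrt_three_sq + 3 * Complex.I_sq)

lemma inv_sixthRoot : sixthRoot⁻¹ = 1 - sixthRoot :=
  inv_eq_of_mul_eq_one_right (by linear_combination -sixthRoot_sq)

lemma sixthRoot_ne_zero : sixthRoot ≠ 0 := fun h => by
  simpa [h] using sixthRoot_sq

lemma norm_sixthRoot : ‖sixthRoot‖ = 1 := by
  have h : sixthRoot ^ 6 = 1 := by
    linear_combination (sixthRoot ^ 4 + sixthRoot ^ 3 - sixthRoot - 1) * sixthRoot_sq
  exact Complex.norm_eq_one_of_pow_eq_one h (by norm_num)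

lemma neg_one_eq_sixthRoot : ((-1 : ℝ) : ℂ) = -(sixthRoot + sixthRoot⁻¹) := by
  rw [inv_sixthRoot]; push_cast; ring

lemma one_eq_neg_sixthRoot : ((1 : ℝ) : ℂ) = -(-sixthRoot + (-sixthRoot)⁻¹) := by
  rw [inv_neg, inv_sixthRoot]; push_cast; ring

lemma sqrt_three_eq_I_mul_sixthRoot :
    ((√3 : ℝ) : ℂ) = -(Complex.I * sixthRoot + (Complex.I * sixthRoot)⁻¹) := by
  rw [mul_inv, inv_sixthRoot, Complex.inv_I, sixthRoot]
  linear_combination (√3 : ℝ) * Complex.I_sq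

lemma norm_neg_sixthRoot : ‖-sixthRoot‖ = 1 := by rw [norm_neg, norm_sixthRoot]

lemma norm_I_mul_sixthRoot : ‖Complex.I * sixthRoot‖ = 1 := by
  rw [norm_mul, norm_sixthRoot, Complex.norm_I, one_mul]

/-- The product `∏ (1 + q^(2n) + q^(4n)) = (q⁶; q⁶)_∞ / (q²; q²)_∞`, written with the denominators
of `f_{-1}(-q)` and `f_1(-q)`. -/
lemma qPochInf_sixthRoot_mul {q : ℂ} (hq : ‖q‖ < 1) :
    (qPochInf (sixthRoot * -q) (-q) * qPochInf (-q / sixthRoot) (-q)) *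
      (qPochInf (-sixthRoot * -q) (-q) * qPochInf (-q / -sixthRoot) (-q)) *
      qPochInf (q ^ 2) (q ^ 2) = qPochInf (q ^ 6) (q ^ 6) := by
  have hω : (sixthRoot ^ 2) ^ 2 + sixthRoot ^ 2 + 1 = 0 := by
    linear_combination (sixthRoot ^ 2 + sixthRoot + 1) * sixthRoot_sq
  have h := qPochInf_mul_cube_root (norm_pow_lt_one hq two_ne_zero) hω (q ^ 2)
  have h1 := qPochInf_mul_qPochInf_neg_neg hq (sixthRoot * q)
  have h2 := qPochInf_mul_qPochInf_neg_neg hq (q / sixthRoot)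
  have e : (q / sixthRoot) ^ 2 = (sixthRoot ^ 2) ^ 2 * q ^ 2 := by
    rw [div_eq_mul_inv, mul_pow, inv_sixthRoot]
    linear_combination -(q ^ 2 * (sixthRoot ^ 2 + sixthRoot - 1)) * sixthRoot_sq
  rw [e] at h2
  rw [mul_pow] at h1
  rw [← h1, ← h2, ← pow_mul] at h
  rw [neg_div_neg_eq, neg_div, neg_mul_neg, mul_neg, ← h]
  ring

end QSeries

theorem mainTheorem4 (q : ℂ) (hq : ‖q‖ < 1) :
    -- every denominator is nonzero, and every series and infinite product converges
    ((∀ n : ℕ, 1 ≤ n →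
        1 + ((-1 : ℝ) : ℂ) * (-q) ^ n + (-q) ^ (2 * n) ≠ 0 ∧
        1 + ((1 : ℝ) : ℂ) * (-q) ^ n + (-q) ^ (2 * n) ≠ 0 ∧
        1 + ((√3 : ℝ) : ℂ) * q ^ n + q ^ (2 * n) ≠ 0) ∧
      QSeries.qPochInf (q ^ 6) (q ^ 6) ≠ 0 ∧
      Summable (QSeries.fTerm (-1) (-q)) ∧
      Summable (QSeries.fTerm 1 (-q)) ∧
      Summable (QSeries.fTerm (√3) q) ∧
      Summable (fun n : ℕ => (-q) ^ (n + 1).choose 2) ∧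
      Multipliable (fun k : ℕ => 1 - q ^ 4 * (q ^ 4) ^ k) ∧
      Multipliable (fun k : ℕ => 1 - q ^ 6 * (q ^ 6) ^ k) ∧
      Multipliable (fun n : ℕ =>
        1 / (1 + ((√3 : ℝ) : ℂ) * q ^ (n + 1) + q ^ (2 * (n + 1))))) ∧
    -- the identity
    (1 + ((√3 : ℝ) : ℂ)) / 2 * QSeries.f (-1) (-q)
        + (3 + ((√3 : ℝ) : ℂ)) / 6 * QSeries.f 1 (-q)
        - QSeries.f (√3) q
      = 2 / ((√3 : ℝ) : ℂ) * QSeries.psi (-q)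
          * (QSeries.qPochInf (q ^ 4) (q ^ 4) / QSeries.qPochInf (q ^ 6) (q ^ 6))
          * ∏' n : ℕ, 1 / (1 + ((√3 : ℝ) : ℂ) * q ^ (n + 1) + q ^ (2 * (n + 1))) := by
  open QSeries in
  have hnq : ‖-q‖ < 1 := by simpa using hq
  have hq6 : ‖q ^ 6‖ < 1 := norm_pow_lt_one hq (by norm_num)
  have hP6 : qPochInf (q ^ 6) (q ^ 6) ≠ 0 := qPochInf_ne_zero_of_norm_lt_one hq6 hq6
  have hprod := hasProd_one_div hq norm_I_mul_sixthRoot sqrt_three_eq_I_mul_sixthRoot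
  refine ⟨⟨fun n hn => ⟨?_, ?_, ?_⟩, hP6, ?_, ?_, ?_, summable_psi hnq,
    multipliable_one_sub_mul_pow (norm_pow_lt_one hq (by norm_num)) _,
    multipliable_one_sub_mul_pow hq6 _, hprod.multipliable⟩, ?_⟩
  · exact one_add_mul_pow_add_pow_ne_zero hnq norm_sixthRoot neg_one_eq_sixthRoot hn
  · exact one_add_mul_pow_add_pow_ne_zero hnq norm_neg_sixthRoot one_eq_neg_sixthRoot hn
  · exact one_add_mul_pow_add_pow_ne_zero hq norm_I_mul_sixthRoot sqrt_three_eq_I_mul_sixthRoot hn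
  · exact summable_fTerm hnq norm_sixthRoot neg_one_eq_sixthRoot
  · exact summable_fTerm hnq norm_neg_sixthRoot one_eq_neg_sixthRoot
  · exact summable_fTerm hq norm_I_mul_sixthRoot sqrt_three_eq_I_mul_sixthRoot
  have hs := sqrt_three_sq
  have hs0 : ((√3 : ℝ) : ℂ) ≠ 0 := fun h => by simp [h] at hs
  rw [hprod.tprod_eq]
  rcases eq_or_ne q 0 with rfl | hq0
  -- At `q = 0` the `q`-difference equations carry no information, but every series is `1`.
  · have hf : ∀ a : ℝ, f a 0 = 1 := fun a => by
      rw [f, tsum_eq_single 0 fun n hn => by simp [fTerm, hn]]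
      simp [fTerm]
    have hpsi : psi 0 = 1 := by
      rw [psi, tsum_eq_single 0 fun n hn => by
        simp [(Nat.pos_of_ne_zero hn).trans_le (le_choose_succ_two n) |>.ne']]
      simp
    simp [hf, hpsi]
    field_simp
    linear_combination 8 * hs
  · have hE := rankCombination_eq hq hq0 sixthRoot_ne_zero
    rw [rankCombination, rankSum_eq_mul_f hnq norm_sixthRoot neg_one_eq_sixthRoot,
      rankSum_eq_mul_f hnq norm_neg_sixthRoot one_eq_neg_sixthRoot,
      rankSum_eq_mul_f hq norm_I_mul_sixthRoot sqrt_three_eq_I_mul_sixthRoot,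
      theta_eq hnq, theta_eq hnq, theta_eq hq] at hE
    have h6 := qPochInf_sixthRoot_mul hq
    have h4 := qPochInf_mul_qPochInf_neg (norm_pow_lt_one hq two_ne_zero) (q ^ 2)
    rw [← pow_mul] at h4
    norm_num at h4
    have hD := qPochInf_mul_qPochInf_div_ne_zero hq norm_I_mul_sixthRoot
    have hx := sixthRoot_ne_zero
    have hI := Complex.I_sq
    have hxs := sixthRoot_sq
    have hsx : ((√3 : ℝ) : ℂ) = -Complex.I * (2 * sixthRoot - 1) := by
      rw [sixthRoot]; linear_combination (√3 : ℝ) * hI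
    -- `2 - x = 1 - x²` is the common factor of the three coefficients of the relation at `x`.
    have hden : 2 - sixthRoot = -(Complex.I * (√3 : ℝ) * sixthRoot) := by
      rw [hsx]; linear_combination 2 * hxs - (2 * sixthRoot ^ 2 - sixthRoot) * hI
    have c1 : (1 - Complex.I) / 2 * (1 + sixthRoot) * (1 - Complex.I * sixthRoot) =
        (2 - sixthRoot) * ((1 + (√3 : ℝ)) / 2) := by
      rw [hsx]
      linear_combination (sixthRoot + sixthRoot ^ 2) / 2 * hI - (1 + 3 * Complex.I) / 2 * hxs
    have c2 : (1 + Complex.I) / 2 * (1 - sixthRoot) * (1 - Complex.I * sixthRoot) =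
        (2 - sixthRoot) * ((3 + (√3 : ℝ)) / 6) := by
      rw [hsx]
      linear_combination (sixthRoot ^ 2 - sixthRoot) / 2 * hI + (Complex.I - 3) / 6 * hxs
    have c3 : (1 - sixthRoot) * (1 + sixthRoot) = 2 - sixthRoot := by linear_combination -hxs
    generalize qPochInf (sixthRoot * -q) (-q) * qPochInf (-q / sixthRoot) (-q) = D₁ at *
    generalize qPochInf (-sixthRoot * -q) (-q) * qPochInf (-q / -sixthRoot) (-q) = D₂ at *
    generalize qPochInf (Complex.I * sixthRoot * q) q *
      qPochInf (q / (Complex.I * sixthRoot)) q = D₃ at *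
    have hR : Complex.I * (√3 : ℝ) * sixthRoot * (2 / (√3 : ℝ) * psi (-q) *
        (qPochInf (q ^ 4) (q ^ 4) / qPochInf (q ^ 6) (q ^ 6)) * D₃⁻¹ *
          (qPochInf (q ^ 6) (q ^ 6) * D₃)) =
        2 * Complex.I * sixthRoot * psi (-q) * qPochInf (q ^ 4) (q ^ 4) := by
      field_simp
    rw [← mul_left_inj' (mul_ne_zero hP6 hD), ← mul_right_inj'
      (mul_ne_zero (mul_ne_zero Complex.I_ne_zero hs0) hx), hR, ← h6, ← h4]
    linear_combination -qPochInf (q ^ 2) (q ^ 2) * hE +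
      D₁ * D₂ * D₃ * qPochInf (q ^ 2) (q ^ 2) * (f (-1) (-q) * c1 + f 1 (-q) * c2 - f (√3) q * c3 +
        ((1 + (√3 : ℝ)) / 2 * f (-1) (-q) + (3 + (√3 : ℝ)) / 6 * f 1 (-q) - f (√3) q) * hden)
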